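/- Let $n\ge 2$. For $d\in\{n-1,n\}$ let $\widetilde{Ein}_{1,d}=\mathbb{S}^{d}\times\mathbb{R}$ be the universal Einstein universe, with the conformal class of $ds^2-dt^2$ and the time orientation $\partial_t$, and let $d_0$ be the round distance on the sphere. View $\widetilde{Ein}_{1,n-1}$ inside $\widetilde{Ein}_{1,n}$ through an equator $\mathbb{S}^{n-1}\subset\mathbb{S}^{n}$, and let $\mathcal{H}_1,\mathcal{H}_2$ be the two open hemispheres of $\mathbb{S}^n$ bounded by this equator, so that $\mathcal{H}_i\times\mathbb{R}$ are two conformal copies of the universal cover of anti-de Sitter space. For a subset $A$ of one of these spacetimes, let $J^{\pm}(A)$ be its causal future and past ($A$ included), and call the complement of $J^+(A)\cup J^-(A)$ the invisible domain of $A$. Let $\Lambda\subset\widetilde{Ein}_{1,n-1}$ be a nonempty compact acausal set (for instance the lift of the limit set of a $P_1$-Anosov representation of an infinite hyperbolic group into $O_0(2,n)$ with negative limit set). For $A \subset \widetilde{Ein}_{1,n-1}$ let $E_i(A)$ be the intersection of $\mathcal{H}_i\times\mathbb{R}$ with the invisible domain of $A$ in $\widetilde{Ein}_{1,n}$, let $\partial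 E(\Lambda)$ be the invisible domain of $\Lambda$ in $\widetilde{Ein}_{1,n-1}$, and let $\Lambda^+$ be the graph of the function $g^+(x)=\inf_{(x_0,t_0)\in\Lambda}\,(t_0+d_0(x,x_0))$ on $\mathbb{S}^{n-1}$. Suppose that $\Lambda$ is not homeomorphic to $\mathbb{S}^{n-1}$. Then, for $i=1,2$, the AdS-regular domain $E_i(\Lambda)$ is the disjoint union of the following three sets: the future globally hyperbolic convex core $E_i(\Lambda^+)$; the past of $\partial E(\Lambda)$ in $E_i(\Lambda)$, that is $J^-(\partial E(\Lambda))\cap E_i(\Lambda)$; and the future horizon, that is the topological boundary of $E_i(\Lambda^+)$ in $E_i(\Lambda)$. -/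

import Mathlib

namespace EinsteinUniverse

noncomputable section

/-- The unit sphere of the Euclidean space of dimension `d`, that is `𝕊^(d-1)`. -/
abbrev Sph (d : ℕ) : Type := Metric.sphere (0 : EuclideanSpace ℝ (Fin d)) 1

/-- The universal Einstein universe of dimension `d` in its conformal model: the manifold
`𝕊^(d-1) × ℝ` with the conformal class of the Lorentzian metric `ds² - dt²` and the time
orientation given by `∂/∂t`. So `Ein n` is `Ein_{1,n-1}` and `Ein (n+1)` is `Ein_{1,n}`
(universal coverings). -/
abbrev Ein (d : ℕ) : Type := Sph d × ℝ

/-- The distance of the round metric of the unit sphere. -/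
def sphDist {d : ℕ} (x y : Sph d) : ℝ := InnerProductGeometry.angle x.1 y.1

/-- A vector `(v, w)` tangent to `𝕊^(d-1) × ℝ` is a future causal vector: it is not spacelike for
`ds² - dt²` and it is in the same cone as `∂/∂t` (in particular it is nonzero). -/
def IsFutureCausal {d : ℕ} (v : EuclideanSpace ℝ (Fin d)) (w : ℝ) : Prop :=
  ‖v‖ ^ 2 - w ^ 2 ≤ 0 ∧ 0 < w

/-- There is a future causal curve of class `C^1`, defined on `[0, 1]`, from `p` to `q`. The curve
`s ↦ (x s, τ s)` and its velocity are written in the ambient space of `𝕊^(d-1) × ℝ`. -/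
def CausalArc {d : ℕ} (p q : Ein d) : Prop :=
  ∃ (x : ℝ → EuclideanSpace ℝ (Fin d)) (τ : ℝ → ℝ),
    ContDiffOn ℝ 1 x (Set.Icc 0 1) ∧ ContDiffOn ℝ 1 τ (Set.Icc 0 1) ∧
    (∀ s ∈ Set.Icc (0 : ℝ) 1, x s ∈ Metric.sphere (0 : EuclideanSpace ℝ (Fin d)) 1) ∧
    (∀ s ∈ Set.Icc (0 : ℝ) 1,
      IsFutureCausal (derivWithin x (Set.Icc 0 1) s) (derivWithin τ (Set.Icc 0 1) s)) ∧
    x 0 = p.1 ∧ τ 0 = p.2 ∧ x 1 = q.1 ∧ τ 1 = q.2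

/-- `p` causally precedes `q`: `p = q`, or there is a piecewise `C^1` future causal curve from `p`
to `q`, that is, a finite concatenation of `C^1` ones. -/
def CausalLE {d : ℕ} (p q : Ein d) : Prop := Relation.ReflTransGen CausalArc p q

/-- The causal future `J⁺(A)`. -/
def causalFuture {d : ℕ} (A : Set (Ein d)) : Set (Ein d) := {q | ∃ p ∈ A, CausalLE p q}

/-- The causal past `J⁻(A)`. -/
def causalPast {d : ℕ} (A : Set (Ein d)) : Set (Ein d) := {q | ∃ p ∈ A, CausalLE q p}

/-- `A` is acausal: no causal curve joins two distinct points of `A`. -/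
def IsAcausal {d : ℕ} (A : Set (Ein d)) : Prop := ∀ p ∈ A, ∀ q ∈ A, CausalLE p q → p = q

/-- The invisible domain of `A`: the points that are not causally related to any point of `A`. -/
def invisibleDomain {d : ℕ} (A : Set (Ein d)) : Set (Ein d) :=
  (causalFuture A ∪ causalPast A)ᶜ

/-- The equatorial embedding `𝕊^(n-1) ⊂ 𝕊^n`, `x ↦ (x, 0)`. -/
def equator {n : ℕ} (x : Sph n) : Sph (n + 1) :=
  ⟨WithLp.toLp 2 (Fin.snoc (α := fun _ => ℝ) (fun j => x.1 j) 0), by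
    have h := x.2
    rw [mem_sphere_zero_iff_norm] at h ⊢
    rw [EuclideanSpace.norm_eq] at h ⊢
    rw [Fin.sum_univ_castSucc]
    simpa using h⟩

/-- The embedding of `Ein_{1,n-1}` in `Ein_{1,n}` (universal coverings). -/
def incl {n : ℕ} (p : Ein n) : Ein (n + 1) := (equator p.1, p.2)

/-- The two open hemispheres of `𝕊^n` bounded by the equator `𝕊^(n-1)`. -/
def hemisphere (n : ℕ) (i : Fin 2) : Set (Sph (n + 1)) :=
  {x | 0 < (-1 : ℝ) ^ (i : ℕ) * x.1 (Fin.last n)}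

/-- The AdS-regular domain `E_i(A)` of a subset `A` of `Ein_{1,n-1}`: the part of the invisible
domain of `A` in `Ein_{1,n}` that lies in the conformal copy `hemisphere n i × ℝ` of the
(universal) anti-de Sitter space. -/
def regularDomain {n : ℕ} (i : Fin 2) (A : Set (Ein n)) : Set (Ein (n + 1)) :=
  invisibleDomain (incl '' A) ∩ {p | p.1 ∈ hemisphere n i}

/-- The conformal boundary `∂E(A)` of the domains `E_i(A)`: the invisible domain of `A` in
`Ein_{1,n-1}`. -/
def conformalBoundary {n : ℕ} (A : Set (Ein n)) : Set (Ein n) := invisibleDomain A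

/-- The function `g⁺ x = inf {t₀ + d₀(x, x₀) | (x₀, t₀) ∈ A}` on `𝕊^(n-1)`, which bounds the
invisible domain of `A` in `Ein_{1,n-1}` from above. -/
def upperFun {n : ℕ} (A : Set (Ein n)) (x : Sph n) : ℝ :=
  ⨅ p : A, (p.1.2 + sphDist x p.1.1)

/-- The graph `A⁺` of `g⁺`. -/
def upperGraph {n : ℕ} (A : Set (Ein n)) : Set (Ein n) := {p | p.2 = upperFun A p.1}

/-- The future globally hyperbolic convex core `E_i(A⁺)` of `E_i(A)`. -/
def futureCore {n : ℕ} (i : Fin 2) (A : Set (Ein n)) : Set (Ein (n + 1)) :=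
  regularDomain i (upperGraph A)

/-- The past of `∂E(A)` in `E_i(A)`: the points of `E_i(A)` from which a future causal curve
reaches `∂E(A)`. -/
def pastOfBoundary {n : ℕ} (i : Fin 2) (A : Set (Ein n)) : Set (Ein (n + 1)) :=
  causalPast (incl '' conformalBoundary A) ∩ regularDomain i A

/-- The future horizon: the topological boundary of `E_i(A⁺)` in the space `E_i(A)`. -/
def futureHorizon {n : ℕ} (i : Fin 2) (A : Set (Ein n)) : Set (Ein (n + 1)) :=
  Subtype.val '' frontier ((Subtype.val : regularDomain i A → Ein (n + 1)) ⁻¹' futureCore i A)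

end

end EinsteinUniverse

/-! In the conformal model causality is metric: `p` precedes `q` iff `sphDist p.1 q.1 ≤ q.2 - p.2`
(`causalLE_iff`). Membership in `E_i(Λ)` thus becomes a family of inequalities on time and distance
to points of `Λ`, and the three pieces are separated by one continuous function `horizonFun`, `h x =
sup_y (g⁺ y - d₀(x, y))`, `y` on the equator.

Inside `E_i(Λ)`, the core is `h < t` (`futureCore_eq`): acausality gives `Λ ⊆ Λ⁺`, and the upper
bounds imposed by `Λ⁺` already follow from those of `Λ` by the triangle inequality. The past of
`∂E(Λ)` is `t < h` (`pastOfBoundary_eq`): a maximizing `y` is then not below a point of `Λ`, so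
`∂E(Λ)` contains points over `y` just under `g⁺ y`. The horizon is `t = h` (`futureHorizon_eq`):
points of the graph can be pushed upwards inside `E_i(Λ)`. Trichotomy concludes. -/

namespace EinsteinUniverse

open Filter Topology

/-! ### The round distance on the sphere. -/

section Sphere

variable {d : ℕ}

theorem norm_sph (x : Sph d) : ‖x.1‖ = 1 := mem_sphere_zero_iff_norm.1 x.2

theorem sph_ne_zero (x : Sph d) : x.1 ≠ 0 := by
  rw [← norm_ne_zero_iff, norm_sph]; exact one_ne_zero

theorem sphDist_nonneg (x y : Sph d) : 0 ≤ sphDist x y := InnerProductGeometry.angle_nonneg _ _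

theorem sphDist_self (x : Sph d) : sphDist x x = 0 :=
  InnerProductGeometry.angle_self (sph_ne_zero x)

theorem sphDist_comm (x y : Sph d) : sphDist x y = sphDist y x :=
  InnerProductGeometry.angle_comm _ _

theorem sphDist_triangle (x y z : Sph d) : sphDist x z ≤ sphDist x y + sphDist y z :=
  InnerProductGeometry.angle_le_angle_add_angle _ _ _

theorem continuous_sphDist {X : Type*} [TopologicalSpace X] {f g : X → Sph d}
    (hf : Continuous f) (hg : Continuous g) : Continuous fun a => sphDist (f a) (g a) := by
  have h : ∀ x y : Sph d, sphDist x y = Real.arccos (inner ℝ x.1 y.1) := fun x y => by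
    rw [sphDist, InnerProductGeometry.angle, norm_sph, norm_sph, mul_one, div_one]
  simp only [h]
  exact Real.continuous_arccos.comp (by fun_prop)

/-- A function that is `1`-Lipschitz for the round distance is continuous. -/
theorem continuous_of_sub_le_sphDist {f : Sph d → ℝ} (hf : ∀ x y, f x ≤ f y + sphDist x y) :
    Continuous f := by
  refine continuous_iff_continuousAt.2 fun x => ?_
  have h0 : Tendsto (fun y => sphDist y x) (𝓝 x) (𝓝 0) := by
    have h : Continuous fun y => sphDist y x :=
      continuous_sphDist continuous_id continuous_const
    have h' : Tendsto (fun y => sphDist y x) (𝓝 x) (𝓝 (sphDist x x)) := h.tendsto x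
    rwa [sphDist_self] at h'
  refine tendsto_iff_dist_tendsto_zero.2 (squeeze_zero (fun _ => dist_nonneg) (fun y => ?_) h0)
  rw [Real.dist_eq, abs_le]
  have h1 := hf x y
  have h2 := hf y x
  rw [sphDist_comm x y] at h1
  constructor <;> linarith

end Sphere

/-! ### Angle versus length for curves on the unit sphere. -/

section Chord

variable {V : Type*} [NormedAddCommGroup V] [InnerProductSpace ℝ V]

/-- Half-angle formula for the chord. It turns a bound on chords, given by the velocity of a curve,
into a bound on angles. -/
theorem angle_eq_two_mul_arcsin {u v : V} (hu : ‖u‖ = 1) (hv : ‖v‖ = 1) :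
    InnerProductGeometry.angle u v = 2 * Real.arcsin (‖u - v‖ / 2) := by
  set θ := InnerProductGeometry.angle u v with hθ
  have h0 : 0 ≤ θ := InnerProductGeometry.angle_nonneg u v
  have hπ : θ ≤ Real.pi := InnerProductGeometry.angle_le_pi u v
  have hcos : Real.cos θ = inner ℝ u v := by
    rw [hθ, InnerProductGeometry.cos_angle, hu, hv]; simp
  have hsq : ‖u - v‖ ^ 2 = 2 - 2 * Real.cos θ := by
    rw [norm_sub_sq_real, hu, hv, hcos]; ring
  have hs : Real.sin (θ / 2) = ‖u - v‖ / 2 := by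
    rw [Real.sin_half_eq_sqrt h0 (by linarith [Real.pi_pos]),
      show (1 - Real.cos θ) / 2 = (‖u - v‖ / 2) ^ 2 by rw [div_pow, hsq]; ring,
      Real.sqrt_sq (by positivity)]
  rw [← hs, Real.arcsin_sin] <;> linarith [Real.pi_pos]

theorem eventually_abs_arcsin_le {C : ℝ} (hC : 1 < C) :
    ∀ᶠ y in 𝓝 (0 : ℝ), |Real.arcsin y| ≤ C * |y| := by
  have h := (Real.hasDerivAt_arcsin (x := 0) (by norm_num) (by norm_num)).hasDerivWithinAt
    (s := Set.univ)
  have h' := h.limsup_norm_slope_le (r := C) (by simpa using hC)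
  rw [nhdsWithin_univ] at h'
  filter_upwards [h'] with y hy
  rcases eq_or_ne y 0 with rfl | hy0
  · simp
  · rw [Real.arcsin_zero, sub_zero, sub_zero, Real.norm_eq_abs, Real.norm_eq_abs,
      inv_mul_lt_iff₀ (abs_pos.2 hy0)] at hy
    linarith

/-- The angle swept by a curve on the unit sphere is at most the increase of a function that
dominates its length. -/
theorem angle_le_of_norm_derivWithin_le {x : ℝ → V} {τ : ℝ → ℝ}
    (hx : ContDiffOn ℝ 1 x (Set.Icc 0 1)) (hτ : ContDiffOn ℝ 1 τ (Set.Icc 0 1))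
    (hs : ∀ s ∈ Set.Icc (0 : ℝ) 1, ‖x s‖ = 1)
    (hd : ∀ s ∈ Set.Icc (0 : ℝ) 1,
      ‖derivWithin x (Set.Icc 0 1) s‖ ≤ derivWithin τ (Set.Icc 0 1) s) :
    InnerProductGeometry.angle (x 0) (x 1) ≤ τ 1 - τ 0 := by
  have hne : ∀ s ∈ Set.Icc (0 : ℝ) 1, x s ≠ 0 := fun s h => by
    rw [← norm_ne_zero_iff, hs s h]; exact one_ne_zero
  have h01 : (0 : ℝ) ∈ Set.Icc (0 : ℝ) 1 := by simp
  have hIci : ∀ s ∈ Set.Ico (0 : ℝ) 1, Set.Icc (0 : ℝ) 1 ∈ 𝓝[≥] s := fun s h =>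
    mem_of_superset (Icc_mem_nhdsGE h.2) (Set.Icc_subset_Icc_left h.1)
  -- The angle from `x 0` need not be differentiable, so only its right slopes are compared with the
  -- derivative of `τ`.
  refine image_le_of_liminf_slope_right_le_deriv_boundary
    (f := fun s => InnerProductGeometry.angle (x 0) (x s)) (a := 0) (b := 1)
    (B := fun s => τ s - τ 0) (B' := fun s => derivWithin τ (Set.Icc 0 1) s) ?_ ?_ ?_ ?_ ?_
    (by simp : (1 : ℝ) ∈ Set.Icc (0 : ℝ) 1)
  · intro s h
    have := InnerProductGeometry.continuousAt_angle (x := (x 0, x s)) (hne 0 h01) (hne s h)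
    exact ContinuousAt.comp_continuousWithinAt
      (g := fun y : V × V => InnerProductGeometry.angle y.1 y.2) (f := fun s => (x 0, x s)) this
      (continuousWithinAt_const.prodMk (hx.continuousOn s h))
  · simp [InnerProductGeometry.angle_self (hne 0 h01)]
  · exact hτ.continuousOn.sub continuousOn_const
  · intro s h
    have := ((hτ.differentiableOn one_ne_zero) s (Set.Ico_subset_Icc_self h)).hasDerivWithinAt
    exact (this.mono_of_mem_nhdsWithin (hIci s h)).sub_const _
  · intro s h r hr
    have hsI := Set.Ico_subset_Icc_self h
    have hτ0 : 0 ≤ derivWithin τ (Set.Icc 0 1) s := (norm_nonneg _).trans (hd s hsI)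
    -- Room between `τ'` and `r`: chord slopes stay below `r₁`, and the factor `r / r₁ > 1` absorbs
    -- the passage from chord to angle.
    obtain ⟨r₁, hr₁, hr₁r⟩ := exists_between hr
    have hr₁0 : 0 < r₁ := hτ0.trans_lt hr₁
    have hxd := ((hx.differentiableOn one_ne_zero) s hsI).hasDerivWithinAt.mono_of_mem_nhdsWithin
      (hIci s h)
    have hxd' := hxd.mono Set.Ioi_subset_Ici_self
    have h1 := hxd'.limsup_norm_slope_le ((hd s hsI).trans_lt hr₁)
    have hlim : Tendsto (fun z => ‖x s - x z‖ / 2) (𝓝[>] s) (𝓝 0) := by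
      have := ((continuousWithinAt_const (b := x s)).sub hxd'.continuousWithinAt).norm.div_const 2
      simpa [ContinuousWithinAt] using this
    have h2 := hlim.eventually (eventually_abs_arcsin_le ((one_lt_div hr₁0).2 hr₁r))
    have h3 : Set.Icc (0 : ℝ) 1 ∈ 𝓝[>] s := nhdsWithin_mono _ Set.Ioi_subset_Ici_self (hIci s h)
    refine Eventually.frequently ?_
    filter_upwards [h1, h2, h3, self_mem_nhdsWithin] with z hz1 hz2 hz3 hz4
    have hzs : 0 < z - s := sub_pos.2 hz4
    rw [slope_def_field, div_lt_iff₀ hzs]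
    have htri := InnerProductGeometry.angle_le_angle_add_angle (x 0) (x s) (x z)
    have harc := angle_eq_two_mul_arcsin (hs s hsI) (hs z hz3)
    rw [abs_of_nonneg (by positivity : 0 ≤ ‖x s - x z‖ / 2)] at hz2
    have hle := (le_abs_self _).trans hz2
    rw [Real.norm_eq_abs, abs_of_pos hzs, inv_mul_lt_iff₀ hzs, norm_sub_rev] at hz1
    have : r / r₁ * ‖x s - x z‖ < r / r₁ * ((z - s) * r₁) :=
      mul_lt_mul_of_pos_left hz1 (div_pos (hr₁0.trans hr₁r) hr₁0)
    have e : r / r₁ * ((z - s) * r₁) = r * (z - s) := by field_simp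
    linarith

end Chord

/-! ### Causal order in terms of distance and time. -/

section Causal

variable {d : ℕ}

theorem CausalArc.sphDist_le {p q : Ein d} (h : CausalArc p q) :
    sphDist p.1 q.1 ≤ q.2 - p.2 := by
  obtain ⟨x, τ, hx, hτ, hs, hd, hx0, hτ0, hx1, hτ1⟩ := h
  have := angle_le_of_norm_derivWithin_le hx hτ (fun s h => mem_sphere_zero_iff_norm.1 (hs s h))
    fun s h => (sq_le_sq₀ (norm_nonneg _) (hd s h).2.le).1 (sub_nonpos.1 (hd s h).1)
  rwa [hx0, hx1, hτ0, hτ1] at this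

theorem CausalLE.sphDist_le {p q : Ein d} (h : CausalLE p q) : sphDist p.1 q.1 ≤ q.2 - p.2 := by
  induction h with
  | refl => simp [sphDist_self]
  | tail _ h ih =>
    have := sphDist_triangle p.1 _ _ |>.trans (add_le_add ih h.sphDist_le)
    linarith

theorem exists_unit_orthogonal (hd : 2 ≤ d) (x y : Sph d) :
    ∃ e : EuclideanSpace ℝ (Fin d), ‖e‖ = 1 ∧ inner ℝ x.1 e = 0 ∧
      y.1 = Real.cos (sphDist x y) • x.1 + Real.sin (sphDist x y) • e := by
  set θ := sphDist x y with hθ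
  have hcos : Real.cos θ = inner ℝ x.1 y.1 := by
    rw [hθ, sphDist, InnerProductGeometry.cos_angle, norm_sph, norm_sph]; simp
  have hxx : inner ℝ x.1 x.1 = 1 := by rw [real_inner_self_eq_norm_sq, norm_sph]; norm_num
  set w := y.1 - Real.cos θ • x.1 with hw
  have hxw : inner ℝ x.1 w = 0 := by
    rw [hw, inner_sub_right, inner_smul_right, hxx, hcos]; ring
  have hww : ‖w‖ ^ 2 = Real.sin θ ^ 2 := by
    rw [hw, norm_sub_sq_real, inner_smul_right, real_inner_comm, ← hcos, norm_smul, norm_sph,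
      norm_sph, Real.norm_eq_abs, mul_one, sq_abs, Real.sin_sq]
    ring
  have hsin : 0 ≤ Real.sin θ :=
    Real.sin_nonneg_of_nonneg_of_le_pi (sphDist_nonneg x y) (InnerProductGeometry.angle_le_pi _ _)
  have hwn : ‖w‖ = Real.sin θ := (sq_eq_sq₀ (norm_nonneg _) hsin).1 hww
  rcases eq_or_ne w 0 with h0 | h0
  -- Here `y = ±x`, so any unit normal to `x` serves; `2 ≤ d` provides one.
  · obtain ⟨v, hv, hv0⟩ : ∃ v ∈ (ℝ ∙ x.1)ᗮ, v ≠ 0 := by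
      refine Submodule.exists_mem_ne_zero_of_ne_bot fun hbot => ?_
      have h1 := Submodule.finrank_add_finrank_orthogonal (ℝ ∙ x.1)
      rw [hbot, finrank_bot, finrank_span_singleton (sph_ne_zero x), finrank_euclideanSpace_fin] at h1
      omega
    refine ⟨‖v‖⁻¹ • v, norm_smul_inv_norm hv0, ?_, ?_⟩
    · rw [inner_smul_right, Submodule.mem_orthogonal_singleton_iff_inner_right.1 hv, mul_zero]
    · rw [← hwn, h0, norm_zero, zero_smul, add_zero]
      exact sub_eq_zero.1 h0
  · refine ⟨‖w‖⁻¹ • w, norm_smul_inv_norm h0, ?_, ?_⟩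
    · rw [inner_smul_right, hxw, mul_zero]
    · rw [← hwn, smul_smul, mul_inv_cancel₀ (norm_ne_zero_iff.2 h0), one_smul, hw]
      abel

/-- A great circle at constant speed `θ`, with time affine in the parameter, is a causal arc. -/
theorem causalArc_of_sphDist_le (hd : 2 ≤ d) {p q : Ein d} (hlt : p.2 < q.2)
    (h : sphDist p.1 q.1 ≤ q.2 - p.2) : CausalArc p q := by
  obtain ⟨e, he, hpe, hq⟩ := exists_unit_orthogonal hd p.1 q.1
  set θ := sphDist p.1 q.1
  have hθ : 0 ≤ θ := sphDist_nonneg _ _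
  have hnorm : ∀ a b : ℝ, ‖a • p.1.1 + b • e‖ ^ 2 = a ^ 2 + b ^ 2 := fun a b => by
    rw [norm_add_sq_real, inner_smul_left, inner_smul_right, hpe, norm_smul, norm_smul, norm_sph,
      he, Real.norm_eq_abs, Real.norm_eq_abs, mul_one, mul_one, sq_abs, sq_abs]
    simp
  have hU : UniqueDiffOn ℝ (Set.Icc (0 : ℝ) 1) := uniqueDiffOn_Icc_zero_one
  refine ⟨fun s => Real.cos (θ * s) • p.1.1 + Real.sin (θ * s) • e,
    fun s => p.2 + (q.2 - p.2) * s, ?_, ?_, ?_, ?_, ?_, ?_, ?_, ?_⟩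
  · exact ContDiff.contDiffOn (by fun_prop)
  · exact ContDiff.contDiffOn (by fun_prop)
  · intro s _
    rw [mem_sphere_zero_iff_norm]
    have := hnorm (Real.cos (θ * s)) (Real.sin (θ * s))
    rw [Real.cos_sq_add_sin_sq] at this
    exact (sq_eq_sq₀ (norm_nonneg _) zero_le_one).1 (by rw [this]; norm_num)
  · intro s hs
    have hl : HasDerivAt (fun s : ℝ => θ * s) θ s := by
      simpa using (hasDerivAt_id s).const_mul θ
    have h1 : HasDerivAt (fun s => Real.cos (θ * s) • p.1.1 + Real.sin (θ * s) • e)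
        ((-Real.sin (θ * s) * θ) • p.1.1 + (Real.cos (θ * s) * θ) • e) s :=
      (hl.cos.smul_const _).add (hl.sin.smul_const _)
    have h2 : HasDerivAt (fun s => p.2 + (q.2 - p.2) * s) (q.2 - p.2) s := by
      simpa using ((hasDerivAt_id s).const_mul (q.2 - p.2)).const_add p.2
    rw [h1.hasDerivWithinAt.derivWithin (hU s hs), h2.hasDerivWithinAt.derivWithin (hU s hs)]
    refine ⟨?_, sub_pos.2 hlt⟩
    rw [hnorm]
    have e1 : (-Real.sin (θ * s) * θ) ^ 2 + (Real.cos (θ * s) * θ) ^ 2 = θ ^ 2 := by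
      linear_combination θ ^ 2 * Real.sin_sq_add_cos_sq (θ * s)
    have e2 : θ ^ 2 ≤ (q.2 - p.2) ^ 2 := pow_le_pow_left₀ hθ h 2
    linarith
  · simp
  · simp
  · simpa using hq.symm
  · simp

theorem causalLE_iff (hd : 2 ≤ d) {p q : Ein d} :
    CausalLE p q ↔ sphDist p.1 q.1 ≤ q.2 - p.2 := by
  refine ⟨CausalLE.sphDist_le, fun h => ?_⟩
  have h0 := sphDist_nonneg p.1 q.1
  rcases lt_or_ge p.2 q.2 with hlt | hge
  · exact Relation.ReflTransGen.single (causalArc_of_sphDist_le hd hlt h)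
  · obtain ⟨e, -, -, hq⟩ := exists_unit_orthogonal hd p.1 q.1
    have hz : sphDist p.1 q.1 = 0 := by linarith
    rw [hz, Real.cos_zero, Real.sin_zero, one_smul, zero_smul, add_zero] at hq
    have : p = q := Prod.ext (Subtype.ext hq.symm) (by linarith)
    rw [this]
    exact Relation.ReflTransGen.refl

end Causal

/-! ### The equatorial embedding is isometric. -/

section Equator

variable {n : ℕ}

theorem sphDist_equator (x y : Sph n) : sphDist (equator x) (equator y) = sphDist x y := by
  rw [sphDist, sphDist, InnerProductGeometry.angle, InnerProductGeometry.angle, norm_sph, norm_sph,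
    norm_sph, norm_sph]
  congr 2
  simp [equator, PiLp.inner_apply, Fin.sum_univ_castSucc]

theorem continuous_equator : Continuous (equator : Sph n → Sph (n + 1)) := by
  refine Continuous.subtype_mk ((PiLp.continuous_toLp 2 _).comp (continuous_pi fun j => ?_)) _
  refine Fin.lastCases ?_ (fun j => ?_) j
  · simpa using continuous_const
  · simp only [Fin.snoc_castSucc]
    fun_prop

theorem sphDist_le_add_equator (x : Sph (n + 1)) (y z : Sph n) :
    sphDist x (equator y) ≤ sphDist x (equator z) + sphDist y z := by
  rw [sphDist_comm y z, ← sphDist_equator z y]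
  exact sphDist_triangle _ _ _

end Equator

/-! ### Invisible domains as inequalities. -/

section InvisibleDomain

variable {d n : ℕ}

theorem mem_invisibleDomain (hd : 2 ≤ d) {A : Set (Ein d)} {p : Ein d} :
    p ∈ invisibleDomain A ↔
      ∀ a ∈ A, p.2 < a.2 + sphDist p.1 a.1 ∧ a.2 - sphDist p.1 a.1 < p.2 := by
  simp only [invisibleDomain, causalFuture, causalPast, Set.mem_compl_iff, Set.mem_union,
    Set.mem_ofPred_eq, causalLE_iff hd]
  push Not
  refine ⟨fun h a ha => ?_, fun h => ⟨fun a ha => ?_, fun a ha => ?_⟩⟩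
  · have h1 := h.1 a ha
    have h2 := h.2 a ha
    rw [sphDist_comm] at h1
    constructor <;> linarith
  · have := h a ha
    rw [sphDist_comm]
    linarith
  · have := h a ha
    linarith

theorem mem_regularDomain (hn : 1 ≤ n) {i : Fin 2} {A : Set (Ein n)} {p : Ein (n + 1)} :
    p ∈ regularDomain i A ↔ p.1 ∈ hemisphere n i ∧
      ∀ a ∈ A, p.2 < a.2 + sphDist p.1 (equator a.1) ∧ a.2 - sphDist p.1 (equator a.1) < p.2 := by
  rw [regularDomain, Set.mem_inter_iff, mem_invisibleDomain (by omega), Set.forall_mem_image,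
    and_comm]
  rfl

end InvisibleDomain

theorem eq_of_sphDist_eq_zero {d : ℕ} {x y : Sph d} (h : sphDist x y = 0) : x = y := by
  refine Subtype.ext ((inner_eq_one_iff_of_norm_eq_one (𝕜 := ℝ) (norm_sph x) (norm_sph y)).1 ?_)
  rw [InnerProductGeometry.inner_eq_mul_norm_of_angle_eq_zero h, norm_sph, norm_sph, mul_one]

/-! ### The upper bound `g⁺` of the invisible domain. -/

section UpperFun

variable {n : ℕ} {Λ : Set (Ein n)}

theorem exists_isMinOn_add_sphDist {d : ℕ} (hne : Λ.Nonempty) (hc : IsCompact Λ)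
    {φ : Sph n → Sph d} (hφ : Continuous φ) (x : Sph d) :
    ∃ a ∈ Λ, ∀ b ∈ Λ, a.2 + sphDist x (φ a.1) ≤ b.2 + sphDist x (φ b.1) :=
  hc.exists_isMinOn hne (f := fun a => a.2 + sphDist x (φ a.1)) (Continuous.continuousOn
    (continuous_snd.add (continuous_sphDist continuous_const (hφ.comp continuous_fst))))

theorem upperFun_le (hc : IsCompact Λ) (x : Sph n) {a : Ein n} (ha : a ∈ Λ) :
    upperFun Λ x ≤ a.2 + sphDist x a.1 := by
  obtain ⟨b, hb, hmin⟩ := exists_isMinOn_add_sphDist ⟨a, ha⟩ hc continuous_id x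
  exact ciInf_le ⟨b.2 + sphDist x b.1, by rintro _ ⟨c, rfl⟩; exact hmin c.1 c.2⟩ (⟨a, ha⟩ : Λ)

theorem exists_upperFun_eq (hne : Λ.Nonempty) (hc : IsCompact Λ) (x : Sph n) :
    ∃ a ∈ Λ, upperFun Λ x = a.2 + sphDist x a.1 := by
  obtain ⟨b, hb, hmin⟩ := exists_isMinOn_add_sphDist hne hc continuous_id x
  have := hne.to_subtype
  exact ⟨b, hb, (upperFun_le hc x hb).antisymm (le_ciInf fun c => hmin c.1 c.2)⟩

theorem upperFun_le_add_sphDist (hne : Λ.Nonempty) (hc : IsCompact Λ) (x y : Sph n) :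
    upperFun Λ x ≤ upperFun Λ y + sphDist x y := by
  obtain ⟨a, ha, h⟩ := exists_upperFun_eq hne hc y
  have h1 := upperFun_le hc x ha
  have h2 := sphDist_triangle x y a.1
  linarith

/-- A point of `Λ` realizing the infimum over `a.1` causally precedes `a`, hence equals it. -/
theorem upperFun_eq_of_mem (hn : 2 ≤ n) (hc : IsCompact Λ) (hac : IsAcausal Λ) {a : Ein n}
    (ha : a ∈ Λ) : upperFun Λ a.1 = a.2 := by
  obtain ⟨b, hb, h⟩ := exists_upperFun_eq ⟨a, ha⟩ hc a.1
  have h1 := upperFun_le hc a.1 ha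
  rw [sphDist_self] at h1
  have : b = a := hac b hb a ha ((causalLE_iff hn).2 (by rw [sphDist_comm]; linarith))
  rw [h, this, sphDist_self, add_zero]

theorem subset_upperGraph (hn : 2 ≤ n) (hc : IsCompact Λ) (hac : IsAcausal Λ) :
    Λ ⊆ upperGraph Λ := fun _ ha => (upperFun_eq_of_mem hn hc hac ha).symm

/-- Over a point outside the projection of an acausal set `Λ`, the lower bound of the invisible
domain of `Λ` lies below the upper bound. -/
theorem sub_sphDist_lt_upperFun (hn : 2 ≤ n) (hc : IsCompact Λ) (hac : IsAcausal Λ) {y : Sph n}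
    (hy : ∀ a ∈ Λ, a.1 ≠ y) {a : Ein n} (ha : a ∈ Λ) : a.2 - sphDist y a.1 < upperFun Λ y := by
  obtain ⟨b, hb, h⟩ := exists_upperFun_eq ⟨a, ha⟩ hc y
  by_contra hlt
  have htri := sphDist_triangle b.1 y a.1
  rw [sphDist_comm b.1 y] at htri
  -- Otherwise `b` would precede `a` by way of the fibre over `y`.
  have hba : b = a := hac b hb a ha ((causalLE_iff hn).2 (by linarith))
  subst hba
  have h0 := sphDist_nonneg y b.1
  have hle : CausalLE ((y, b.2) : Ein n) b := (causalLE_iff hn).2 (by dsimp only; linarith)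
  have hge : sphDist y b.1 = 0 := by linarith
  exact hy b hb (eq_of_sphDist_eq_zero hge).symm

end UpperFun

/-! ### The three pieces as regions above, below and on the graph of `horizonFun`. -/

section Horizon

variable {n : ℕ} {Λ : Set (Ein n)}

/-- The function on `𝕊^n` whose graph bounds the invisible domain of `Λ⁺` from below. -/
noncomputable def horizonFun (Λ : Set (Ein n)) (x : Sph (n + 1)) : ℝ :=
  ⨆ y : Sph n, (upperFun Λ y - sphDist x (equator y))

theorem exists_horizonFun (hne : Λ.Nonempty) (hc : IsCompact Λ) (x : Sph (n + 1)) :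
    (∃ y, horizonFun Λ x = upperFun Λ y - sphDist x (equator y)) ∧
      ∀ y, upperFun Λ y - sphDist x (equator y) ≤ horizonFun Λ x := by
  have : Nonempty (Sph n) := ⟨hne.some.1⟩
  have : CompactSpace (Sph n) := Metric.sphere.compactSpace _ _
  have hcont : Continuous fun y => upperFun Λ y - sphDist x (equator y) :=
    (continuous_of_sub_le_sphDist (upperFun_le_add_sphDist hne hc)).sub
      (continuous_sphDist continuous_const continuous_equator)
  obtain ⟨y, -, hy⟩ := isCompact_univ.exists_isMaxOn Set.univ_nonempty hcont.continuousOn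
  have hmax : ∀ z, upperFun Λ z - sphDist x (equator z) ≤ upperFun Λ y - sphDist x (equator y) :=
    fun z => hy (Set.mem_univ z)
  have hle : ∀ z, upperFun Λ z - sphDist x (equator z) ≤ horizonFun Λ x :=
    le_ciSup ⟨_, Set.forall_mem_range.2 hmax⟩
  exact ⟨⟨y, (ciSup_le hmax).antisymm (hle y)⟩, hle⟩

theorem continuous_horizonFun (hne : Λ.Nonempty) (hc : IsCompact Λ) :
    Continuous (horizonFun Λ) := by
  refine continuous_of_sub_le_sphDist fun x z => ?_
  obtain ⟨y, hy⟩ := (exists_horizonFun hne hc x).1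
  have h1 := (exists_horizonFun hne hc z).2 y
  have h2 := sphDist_triangle z x (equator y)
  rw [sphDist_comm z x] at h2
  linarith

theorem futureCore_eq (hn : 2 ≤ n) (hne : Λ.Nonempty) (hc : IsCompact Λ) (hac : IsAcausal Λ)
    (i : Fin 2) : futureCore i Λ = {p | p ∈ regularDomain i Λ ∧ horizonFun Λ p.1 < p.2} := by
  ext p
  rw [Set.mem_ofPred_eq, futureCore, mem_regularDomain (by omega), mem_regularDomain (by omega)]
  obtain ⟨⟨y, hy⟩, hle⟩ := exists_horizonFun hne hc p.1
  constructor
  · rintro ⟨hH, h⟩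
    refine ⟨⟨hH, fun a ha => h a (subset_upperGraph hn hc hac ha)⟩, ?_⟩
    rw [hy]
    exact (h (y, upperFun Λ y) rfl).2
  · rintro ⟨⟨hH, h⟩, hlt⟩
    refine ⟨hH, fun b hb => ?_⟩
    have hb' : b.2 = upperFun Λ b.1 := hb
    refine ⟨?_, by rw [hb']; exact (hle b.1).trans_lt hlt⟩
    -- `b` lies on a light ray issued from `a`, so the upper bound from `a` implies the one from
    -- `b`.
    obtain ⟨a, ha, hba⟩ := exists_upperFun_eq hne hc b.1
    have h1 := (h a ha).1
    have h2 := sphDist_le_add_equator p.1 a.1 b.1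
    rw [sphDist_comm a.1 b.1] at h2
    linarith

theorem pastOfBoundary_eq (hn : 2 ≤ n) (hne : Λ.Nonempty) (hc : IsCompact Λ) (hac : IsAcausal Λ)
    (i : Fin 2) : pastOfBoundary i Λ = {p | p ∈ regularDomain i Λ ∧ p.2 < horizonFun Λ p.1} := by
  ext p
  rw [Set.mem_ofPred_eq, pastOfBoundary, Set.mem_inter_iff, and_comm]
  refine and_congr_right fun hp => ?_
  obtain ⟨⟨y, hy⟩, hle⟩ := exists_horizonFun hne hc p.1
  simp only [causalPast, Set.mem_ofPred_eq, Set.exists_mem_image, conformalBoundary,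
    mem_invisibleDomain hn, causalLE_iff (show 2 ≤ n + 1 by omega)]
  constructor
  · rintro ⟨q, hq, hpq⟩
    obtain ⟨a, ha, hqa⟩ := exists_upperFun_eq hne hc q.1
    have h1 := (hq a ha).1
    have h2 := hle q.1
    simp only [incl] at hpq
    linarith
  · intro hlt
    rw [mem_regularDomain (by omega)] at hp
    -- Over a point `a` of `Λ`, the value `a.2 - sphDist p.1 (equator a.1)` is below `p.2`,
    -- contradicting `hlt`.
    have hyK : ∀ a ∈ Λ, a.1 ≠ y := by
      rintro a ha rfl
      have := (hp.2 a ha).2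
      rw [upperFun_eq_of_mem hn hc hac ha] at hy
      linarith
    obtain ⟨b, hb, hmax⟩ : ∃ b ∈ Λ, ∀ a ∈ Λ, a.2 - sphDist y a.1 ≤ b.2 - sphDist y b.1 :=
      hc.exists_isMaxOn hne (f := fun a => a.2 - sphDist y a.1) (Continuous.continuousOn
        (continuous_snd.sub (continuous_sphDist continuous_const continuous_fst)))
    -- `s` lies above the lower bound of `∂E(Λ)` over `y` and after light from `p` arrives there,
    -- yet below `g⁺ y`.
    obtain ⟨s, hs1, hs2⟩ := exists_between (max_lt (sub_sphDist_lt_upperFun hn hc hac hyK hb)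
      (show p.2 + sphDist p.1 (equator y) < upperFun Λ y by linarith))
    rw [max_lt_iff] at hs1
    refine ⟨(y, s), fun a ha => ⟨hs2.trans_le (upperFun_le hc y ha),
      (hmax a ha).trans_lt hs1.1⟩, ?_⟩
    simp only [incl]
    linarith

theorem futureHorizon_eq (hn : 2 ≤ n) (hne : Λ.Nonempty) (hc : IsCompact Λ) (hac : IsAcausal Λ)
    (i : Fin 2) : futureHorizon i Λ = {p | p ∈ regularDomain i Λ ∧ p.2 = horizonFun Λ p.1} := by
  have hpre : (Subtype.val : regularDomain i Λ → Ein (n + 1)) ⁻¹' futureCore i Λ =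
      {p | horizonFun Λ p.1.1 < p.1.2} := by
    ext p
    simp [futureCore_eq hn hne hc hac]
  have hcont : Continuous fun p : regularDomain i Λ => horizonFun Λ p.1.1 :=
    (continuous_horizonFun hne hc).comp (continuous_fst.comp continuous_subtype_val)
  have hcont' : Continuous fun p : regularDomain i Λ => p.1.2 :=
    continuous_snd.comp continuous_subtype_val
  rw [futureHorizon, hpre]
  ext p
  simp only [Set.mem_image, Set.mem_ofPred_eq, Subtype.exists, exists_and_right, exists_eq_right]
  rw [← exists_prop]
  refine exists_congr fun hp => ⟨fun h => (frontier_lt_subset_eq hcont hcont' h).symm, fun h => ?_⟩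
  -- The frontier is closure minus interior; a point with `t = h` is outside the open set `h < t`,
  -- so only the closure needs an argument.
  refine ⟨?_, fun hint => ?_⟩
  rotate_left
  · have hlt := interior_subset hint
    rw [Set.mem_ofPred_eq] at hlt
    exact hlt.ne h.symm
  obtain ⟨hH, hlt⟩ := (mem_regularDomain (by omega)).1 hp
  obtain ⟨b, hb, hmin⟩ := exists_isMinOn_add_sphDist hne hc continuous_equator p.1
  set m := b.2 + sphDist p.1 (equator b.1) with hm
  have hpm : p.2 < m := (hlt b hb).1
  -- `m` is the upper bound of `E_i(Λ)` over `p.1`, so the vertical segment above `p` stays in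
  -- `E_i(Λ)` and lies in the core.
  have hmem : ∀ t ∈ Set.Ioo p.2 m, ((p.1, t) : Ein (n + 1)) ∈ regularDomain i Λ := fun t ht =>
    (mem_regularDomain (by omega)).2
      ⟨hH, fun a ha => ⟨ht.2.trans_le (hmin a ha), (hlt a ha).2.trans ht.1⟩⟩
  rw [mem_closure_iff_nhds]
  intro U hU
  obtain ⟨W, hW, hWU⟩ := mem_nhds_subtype _ _ _ |>.1 hU
  have hline : Tendsto (fun t : ℝ => ((p.1, t) : Ein (n + 1))) (𝓝[>] p.2) (𝓝 p) :=
    (Continuous.tendsto (by fun_prop) p.2).mono_left nhdsWithin_le_nhds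
  obtain ⟨t, htW, ht⟩ := ((hline.eventually hW).and (Ioo_mem_nhdsGT hpm)).exists
  exact ⟨⟨(p.1, t), hmem t ht⟩, hWU htW, h.symm.trans_lt ht.1⟩

end Horizon

end EinsteinUniverse

theorem proposition5 (n : ℕ) (hn : 2 ≤ n) (Λ : Set (EinsteinUniverse.Ein n))
    (hne : Λ.Nonempty) (hcompact : IsCompact Λ) (hacausal : EinsteinUniverse.IsAcausal Λ)
    (hsphere : ¬ Nonempty (Λ ≃ₜ EinsteinUniverse.Sph n)) (i : Fin 2) :
    EinsteinUniverse.regularDomain i Λ =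
        EinsteinUniverse.futureCore i Λ ∪ EinsteinUniverse.pastOfBoundary i Λ ∪
          EinsteinUniverse.futureHorizon i Λ ∧
      Disjoint (EinsteinUniverse.futureCore i Λ) (EinsteinUniverse.pastOfBoundary i Λ) ∧
      Disjoint (EinsteinUniverse.futureCore i Λ) (EinsteinUniverse.futureHorizon i Λ) ∧
      Disjoint (EinsteinUniverse.pastOfBoundary i Λ) (EinsteinUniverse.futureHorizon i Λ) := by
  rw [EinsteinUniverse.futureCore_eq hn hne hcompact hacausal,
    EinsteinUniverse.pastOfBoundary_eq hn hne hcompact hacausal,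
    EinsteinUniverse.futureHorizon_eq hn hne hcompact hacausal]
  refine ⟨?_, ?_, ?_, ?_⟩
  · ext p
    have := lt_trichotomy (EinsteinUniverse.horizonFun Λ p.1) p.2
    simp only [Set.mem_union, Set.mem_ofPred_eq, ← and_or_left, eq_comm (a := p.2)]
    tauto
  · exact Set.disjoint_left.2 fun p h h' => lt_asymm h.2 h'.2
  · exact Set.disjoint_left.2 fun p h h' => h.2.ne h'.2.symm
  · exact Set.disjoint_left.2 fun p h h' => h.2.ne h'.2
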